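/- Let $N,d\ge 1$. Let $Z_{i,t}$ ($i=1,\dots,N$, $t=1,2,\dots$) be independent and identically distributed (over both $i$ and $t$) random vectors in $\mathbb R^d$ whose log-moment generating function $\Lambda(\lambda)=\log\mathbb E[e^{\lambda^\top Z_{i,t}}]$ satisfies $\Lambda(\lambda)<+\infty$ for every $\lambda\in\mathbb R^d$, and let $$I(x)=\sup_{\lambda\in\mathbb R^d}\bigl(x^\top\lambda-\Lambda(\lambda)\bigr),\qquad x\in\mathbb R^d,$$ be its conjugate (the Cramér rate function). Let $W_1,W_2,\dots$ be random (row-)stochastic $N\times N$ matrices (entrywise nonnegative, with rows summing to $1$), not necessarily symmetric and with an arbitrary joint distribution, in particular possibly dependent over time, such that the sequence $(W_t)_{t\ge1}$ is independent of the family $(Z_{i,t})_{1\le i\le N,\,t\ge1}$. Define the states of the nodes by $X_{i,0}=0$ and $$X_{i,t}=\sum_{j=1}^N [W_t]_{ij}\Bigl(\tfrac{t-1}{t}\,X_{j,t-1}+\tfrac1t\,Z_{j,t}\Bigr),\qquad t\ge 1,\ i=1,\dots,N.$$ Then for every Borel set $G\subseteq\mathbb R^d$ and every node $i$, $$-\inf_{x\in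 G^{\mathrm o}} N I(x)\;\le\;\liminf_{t\to+\infty}\frac1t\log\mathbb P(X_{i,t}\in G)\;\le\;\limsup_{t\to+\infty}\frac1t\log\mathbb P(X_{i,t}\in G)\;\le\;-\inf_{x\in\overline G} I(x),$$ where $G^{\mathrm o}$ and $\overline G$ are the interior and the closure of $G$, $\log 0=-\infty$ and $\inf\emptyset=+\infty$. -/

import Mathlib

open MeasureTheory ProbabilityTheory Filter
open scoped ENNReal

noncomputable section

namespace DistributedInference

/-- The extended-real-valued log-moment generating function
`Λ(ξ) = log E[exp ⟪ξ, Y⟫]` of a random vector `Y`; it equals `⊤` where the expectation is infinite. -/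
def logMGF {Ω : Type*} [MeasurableSpace Ω] {d : ℕ} (μ : Measure Ω)
    (Y : Ω → EuclideanSpace ℝ (Fin d)) (ξ : EuclideanSpace ℝ (Fin d)) : EReal :=
  ENNReal.log (∫⁻ ω, ENNReal.ofReal (Real.exp (inner ℝ ξ (Y ω))) ∂μ)

/-- The conjugate (Fenchel-Legendre transform) `x ↦ sup_ξ (⟪x, ξ⟫ - Λ(ξ))`, with values in `[-∞, ∞]`. -/
def conjugate {d : ℕ} (L : EuclideanSpace ℝ (Fin d) → EReal) (x : EuclideanSpace ℝ (Fin d)) :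
    EReal :=
  ⨆ ξ : EuclideanSpace ℝ (Fin d), ((inner ℝ x ξ : ℝ) : EReal) - L ξ

/-- The Cramér rate function of a random vector `Y`: the conjugate of its log-moment generating
function. -/
def rateFunction {Ω : Type*} [MeasurableSpace Ω] {d : ℕ} (μ : Measure Ω)
    (Y : Ω → EuclideanSpace ℝ (Fin d)) : EuclideanSpace ℝ (Fin d) → EReal :=
  conjugate (logMGF μ Y)

/-- The states of the consensus+innovations algorithm with weight matrices `W 1, W 2, …` and
observations `Z j 1, Z j 2, …` (the values at time `0` are never used): `X_{i,0} = 0` and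
`X_{i,t} = ∑ j, W_{ij,t} ((t-1)/t X_{j,t-1} + 1/t Z_{j,t})` for `t ≥ 1`. -/
def state {N d : ℕ} (W : ℕ → Matrix (Fin N) (Fin N) ℝ)
    (Z : Fin N → ℕ → EuclideanSpace ℝ (Fin d)) : ℕ → Fin N → EuclideanSpace ℝ (Fin d)
  | 0 => fun _ => 0
  | t + 1 => fun i => ∑ j, W (t + 1) i j •
      (((t : ℝ) / ((t : ℝ) + 1)) • state W Z t j + ((1 : ℝ) / ((t : ℝ) + 1)) • Z j (t + 1))

/-- The normalized log-probability `(1/t) log P(X_{i,t} ∈ G)`, with `log 0 = -∞`. -/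
def logProb {Ω : Type*} [MeasurableSpace Ω] {N d : ℕ} (μ : Measure Ω)
    (W : ℕ → Ω → Matrix (Fin N) (Fin N) ℝ) (Z : Fin N → ℕ → Ω → EuclideanSpace ℝ (Fin d))
    (i : Fin N) (G : Set (EuclideanSpace ℝ (Fin d))) (t : ℕ) : EReal :=
  (((1 : ℝ) / (t : ℝ) : ℝ) : EReal) *
    ENNReal.log (μ {ω | state (fun s => W s ω) (fun j s => Z j s ω) t i ∈ G})

end DistributedInference

end

/-!
Multiplying by `t`, the state `t X_{i,t}` is a combination `∑ s, ∑ j, a s j • Z j s` whose weights,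
entries of products of stochastic matrices, satisfy `0 ≤ a s j` and `∑ j, a s j = 1`. Let `S t` be
the sum of all observations up to time `t`. Since the logarithmic moment generating function `Λ` is
convex, `Λ (η + a • ξ) ≤ (1 - a) Λ(η) + a Λ(η + ξ)` for `0 ≤ a ≤ 1`, and independence gives
`E exp (⟪η, S t⟫ + t ⟪ξ, X_{i,t}⟫) ≤ exp (t (N Λ(η) + Λ(η + ξ) - Λ(η)))`,
a bound in which the weights no longer appear. It therefore survives averaging over random weights
that are independent of the observations (`lintegral_exp_state_le`), and is all that
is used about the weight matrices.

Upper bound. With `η = 0` the bound reads `E exp (t ⟪ξ, X_{i,t}⟫) ≤ exp (t Λ(ξ))`, so that each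
half-space `α < ⟪x, ξ⟫ - Λ(ξ)` has probability at most `exp (-t α)`. If `α` is below the infimum of
the rate on a closed set, finitely many such half-spaces cover it
(`exists_finset_halfSpace_cover`), because the coordinate directions confine the remaining part of
the set to a compact set.

Lower bound. If `y = ∇Λ(η)`, then tilting the law of every observation by `η` makes `X_{i,t}`
concentrate at `y`, because the bound controls the exponential moments of `X_{i,t}` under the tilted
law; the cost of tilting `N t` observations is `exp (-t N (⟪y, η⟫ - Λ(η)))` to
leading order, whence the factor `N` in the rate (`exists_le_measure_of_hasDerivAt`). An arbitrary
point of finite rate is approximated by such gradients `y` whose rate is no larger, through a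
quadratic regularization of the supremum that defines the rate (`exists_gradient_mem`).
-/

namespace DistributedInference

open scoped RealInnerProductSpace Topology

variable {d : ℕ}

/-! ### Cumulants of a law on `ℝᵈ` -/

/-- The logarithmic moment generating function of a law `ν` on `ℝᵈ`, as a real number. It carries a
junk value at every `ξ` where `x ↦ exp ⟪ξ, x⟫` is not `ν`-integrable. -/
noncomputable def cumulant (ν : Measure (EuclideanSpace ℝ (Fin d)))
    (ξ : EuclideanSpace ℝ (Fin d)) : ℝ :=
  Real.log (∫ x, Real.exp ⟪ξ, x⟫ ∂ν)

section Cumulant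

variable {ν : Measure (EuclideanSpace ℝ (Fin d))} [IsProbabilityMeasure ν]

lemma exp_cumulant {ξ : EuclideanSpace ℝ (Fin d)}
    (h : Integrable (fun x => Real.exp ⟪ξ, x⟫) ν) :
    Real.exp (cumulant ν ξ) = ∫ x, Real.exp ⟪ξ, x⟫ ∂ν :=
  Real.exp_log (integral_exp_pos h)

lemma cumulant_zero : cumulant ν 0 = 0 := by
  simp [cumulant]

lemma lintegral_exp_inner {ξ : EuclideanSpace ℝ (Fin d)}
    (h : Integrable (fun x => Real.exp ⟪ξ, x⟫) ν) :
    ∫⁻ x, ENNReal.ofReal (Real.exp ⟪ξ, x⟫) ∂ν = ENNReal.ofReal (Real.exp (cumulant ν ξ)) := by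
  rw [exp_cumulant h, ofReal_integral_eq_lintegral_ofReal h (ae_of_all _ fun _ => by positivity)]

variable (hν : ∀ ξ, Integrable (fun x => Real.exp ⟪ξ, x⟫) ν)
include hν

/-- Integrating the convexity inequality of `exp` between the normalized exponents
`⟪ξ, x⟫ - Λ(ξ)` and `⟪ζ, x⟫ - Λ(ζ)` gives the Hölder inequality for the moment generating function,
that is, the convexity of its logarithm. -/
lemma convexOn_cumulant : ConvexOn ℝ Set.univ (cumulant ν) := by
  refine ⟨convex_univ, fun ξ _ ζ _ a b ha hb hab => ?_⟩
  have hnorm (ξ) : ∫ x, Real.exp (⟪ξ, x⟫ - cumulant ν ξ) ∂ν = 1 := by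
    simp_rw [Real.exp_sub]
    rw [integral_div, exp_cumulant (hν ξ), div_self (integral_exp_pos (hν ξ)).ne']
  have hint (ξ) (c : ℝ) : Integrable (fun x => Real.exp (⟪ξ, x⟫ - c)) ν := by
    simp_rw [Real.exp_sub]
    exact (hν ξ).div_const _
  have key : ∫ x, Real.exp (⟪a • ξ + b • ζ, x⟫ - (a * cumulant ν ξ + b * cumulant ν ζ)) ∂ν ≤ 1 := by
    calc _ ≤ ∫ x, (a * Real.exp (⟪ξ, x⟫ - cumulant ν ξ)
            + b * Real.exp (⟪ζ, x⟫ - cumulant ν ζ)) ∂ν := by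
          refine integral_mono (hint _ _)
            (((hint _ _).const_mul _).add ((hint _ _).const_mul _)) fun x => ?_
          have := convexOn_exp.2 (Set.mem_univ (⟪ξ, x⟫ - cumulant ν ξ))
            (Set.mem_univ (⟪ζ, x⟫ - cumulant ν ζ)) ha hb hab
          simp only [smul_eq_mul] at this
          refine le_trans (le_of_eq ?_) this
          rw [inner_add_left, real_inner_smul_left, real_inner_smul_left]
          ring_nf
      _ = 1 := by
          rw [integral_add ((hint _ _).const_mul _) ((hint _ _).const_mul _),
            integral_const_mul, integral_const_mul, hnorm, hnorm]
          linarith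
  simp_rw [Real.exp_sub] at key
  rw [integral_div, ← exp_cumulant (hν _), ← Real.exp_sub, Real.exp_le_one_iff] at key
  simpa using key

lemma continuous_cumulant : Continuous (cumulant ν) :=
  continuousOn_univ.1 ((convexOn_cumulant hν).continuousOn isOpen_univ)

/-- Along a line through `η`, the function `Λ - Λ(η)` is the cumulant generating function of a
linear form under the law tilted by `η`. -/
lemma differentiableAt_cumulant_line (η ξ : EuclideanSpace ℝ (Fin d)) :
    DifferentiableAt ℝ (fun θ : ℝ => cumulant ν (η + θ • ξ)) 0 := by
  have hadd (θ : ℝ) (x : EuclideanSpace ℝ (Fin d)) :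
      ⟪η + θ • ξ, x⟫ = ⟪η, x⟫ + θ * ⟪ξ, x⟫ := by
    rw [inner_add_left, real_inner_smul_left]
  have hint : integrableExpSet (fun x => ⟪ξ, x⟫) (ν.tilted fun x => ⟪η, x⟫) = Set.univ := by
    refine Set.eq_univ_of_forall fun θ => ?_
    refine (integrable_tilted_iff (hν η) _).2 ?_
    refine (hν (η + θ • ξ)).congr (ae_of_all _ fun x => ?_)
    simp only [hadd, Real.exp_add, smul_eq_mul]
  have : IsProbabilityMeasure (ν.tilted fun x => ⟪η, x⟫) := isProbabilityMeasure_tilted (hν η)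
  have heq (θ : ℝ) : cumulant ν (η + θ • ξ) =
      cumulant ν η + cgf (fun x => ⟪ξ, x⟫) (ν.tilted fun x => ⟪η, x⟫) θ := by
    rw [cgf, mgf, integral_exp_tilted, Real.log_div]
    · simp only [Pi.add_apply, cumulant, hadd]
      ring
    · refine (integral_exp_pos ((hν (η + θ • ξ)).congr (ae_of_all _ fun x => ?_))).ne'
      simp [hadd]
    · exact (integral_exp_pos (hν η)).ne'
  simp_rw [heq]
  refine (analyticAt_cgf ?_).differentiableAt.const_add _
  simp [hint]

/-- Every `x` with finite rate is approximated by points `y` in the range of the gradient of `Λ`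
whose rate is no larger. Such a `y` comes from the maximizer `η` of the coercive function
`ξ ↦ ⟪x, ξ⟫ - Λ(ξ) - ε / 2 ‖ξ‖²`: the first-order condition says that `y = x - ε η` is the
gradient of `Λ` at `η`. Comparing with the value at `0` gives `ε ‖η‖² ≤ 2 v`, so
that `y → x` as `ε → 0`. -/
lemma exists_gradient_mem {x : EuclideanSpace ℝ (Fin d)} {v : ℝ}
    (hv : ∀ ξ, ⟪x, ξ⟫ - cumulant ν ξ ≤ v) {U : Set (EuclideanSpace ℝ (Fin d))} (hU : U ∈ 𝓝 x) :
    ∃ y ∈ U, ∃ η, ⟪y, η⟫ - cumulant ν η ≤ v ∧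
      ∀ ξ, HasDerivAt (fun θ : ℝ => cumulant ν (η + θ • ξ)) ⟪y, ξ⟫ 0 := by
  obtain ⟨r, hr, hrU⟩ := Metric.mem_nhds_iff.1 hU
  have hv0 : 0 ≤ v := by simpa [cumulant_zero] using hv 0
  -- `ε` is chosen so that `2 ε v < r²`
  obtain ⟨ε, hε, hεr⟩ : ∃ ε : ℝ, 0 < ε ∧ 2 * ε * v < r ^ 2 := by
    refine ⟨r ^ 2 / (2 * (v + 1)), by positivity, ?_⟩
    rw [show 2 * (r ^ 2 / (2 * (v + 1))) * v = r ^ 2 * (v / (v + 1)) by field_simp]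
    have : v / (v + 1) < 1 := (div_lt_one (by positivity)).2 (by linarith)
    nlinarith [pow_pos hr 2]
  set g : EuclideanSpace ℝ (Fin d) → ℝ :=
    fun ξ => ⟪x, ξ⟫ - cumulant ν ξ - ε / 2 * ‖ξ‖ ^ 2 with hg
  have hgc : Continuous g := by
    have := continuous_cumulant hν
    fun_prop
  have hg0 : g 0 = 0 := by simp [hg, cumulant_zero]
  obtain ⟨η, hη⟩ := hgc.exists_forall_ge' (0 : EuclideanSpace ℝ (Fin d)) (by
    have h1 : Tendsto (fun ξ : EuclideanSpace ℝ (Fin d) => ε / 2 * ‖ξ‖ ^ 2)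
        (cocompact (EuclideanSpace ℝ (Fin d))) atTop :=
      Tendsto.const_mul_atTop (by positivity)
        ((tendsto_pow_atTop two_ne_zero).comp tendsto_norm_cocompact_atTop)
    filter_upwards [h1.eventually_ge_atTop v] with ξ hξ
    rw [hg0]
    have := hv ξ
    simp only [hg]
    linarith)
  have hη0 := hη 0
  rw [hg0] at hη0
  have hvη := hv η
  simp only [hg] at hη0
  have hsq : 0 ≤ ε / 2 * ‖η‖ ^ 2 := by positivity
  refine ⟨x - ε • η, hrU ?_, η, ?_, fun ξ => ?_⟩
  · rw [Metric.mem_ball, dist_eq_norm, sub_sub_cancel_left, norm_neg, norm_smul, Real.norm_eq_abs,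
      abs_of_pos hε]
    refine lt_of_pow_lt_pow_left₀ 2 hr.le ?_
    nlinarith
  · rw [inner_sub_left, real_inner_smul_left, real_inner_self_eq_norm_sq]
    linarith
  · have hd := (differentiableAt_cumulant_line hν η ξ).hasDerivAt
    set D := deriv (fun θ : ℝ => cumulant ν (η + θ • ξ)) 0
    have hquad (θ : ℝ) : g (η + θ • ξ) = (⟪x, η⟫ + θ * ⟪x, ξ⟫) - cumulant ν (η + θ • ξ)
        - ε / 2 * (‖η‖ ^ 2 + θ * (2 * ⟪η, ξ⟫) + θ ^ 2 * ‖ξ‖ ^ 2) := by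
      simp only [hg]
      rw [inner_add_right, real_inner_smul_right, norm_add_sq_real, real_inner_smul_right,
        norm_smul, mul_pow, Real.norm_eq_abs, sq_abs]
      ring
    have hder : HasDerivAt (fun θ : ℝ => g (η + θ • ξ)) (⟪x, ξ⟫ - D - ε * ⟪η, ξ⟫) 0 := by
      simp_rw [hquad]
      have hid := hasDerivAt_id (0 : ℝ)
      have h2 := (((hid.mul_const ⟪x, ξ⟫).const_add ⟪x, η⟫).sub hd).sub
        ((((hid.mul_const (2 * ⟪η, ξ⟫)).const_add (‖η‖ ^ 2)).add
          ((hid.pow 2).mul_const (‖ξ‖ ^ 2))).const_mul (ε / 2))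
      refine h2.congr_deriv ?_
      simp
      ring
    have hmax : IsLocalMax (fun θ : ℝ => g (η + θ • ξ)) 0 :=
      Eventually.of_forall fun θ => by simpa using hη (η + θ • ξ)
    have h0 := hmax.hasDerivAt_eq_zero hder
    refine hd.congr_deriv ?_
    rw [inner_sub_left, real_inner_smul_left]
    linarith

end Cumulant

/-! ### Exponential estimates and large deviations -/

section LargeDeviations

variable {Ω : Type*} [MeasurableSpace Ω] {μ : Measure Ω}

lemma limsup_log_le {p : ℕ → ℝ≥0∞} {c α : ℝ}
    (h : ∀ᶠ t : ℕ in atTop, p t ≤ ENNReal.ofReal (Real.exp (c - t * α))) :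
    limsup (fun t : ℕ => (((1 : ℝ) / (t : ℝ) : ℝ) : EReal) * ENNReal.log (p t)) atTop
      ≤ ((-α : ℝ) : EReal) := by
  have hlim : Tendsto (fun t : ℕ => ((c / t - α : ℝ) : EReal)) atTop (𝓝 ((-α : ℝ) : EReal)) := by
    refine EReal.tendsto_coe.2 ?_
    simpa using (tendsto_const_div_atTop_nhds_zero_nat c).sub_const α
  rw [← hlim.limsup_eq]
  refine limsup_le_limsup ?_
  filter_upwards [h, eventually_gt_atTop 0] with t ht ht0
  have ht0' : (0 : ℝ) < t := by exact_mod_cast ht0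
  calc _ ≤ (((1 : ℝ) / (t : ℝ) : ℝ) : EReal)
          * ENNReal.log (ENNReal.ofReal (Real.exp (c - t * α))) :=
        mul_le_mul_of_nonneg_left (ENNReal.log_le_log ht)
          (EReal.coe_nonneg.2 (by positivity))
    _ = _ := by
        rw [ENNReal.log_ofReal_of_pos (Real.exp_pos _), Real.log_exp, ← EReal.coe_mul]
        congr 1
        field_simp

lemma le_liminf_log {p : ℕ → ℝ≥0∞} {c α : ℝ}
    (h : ∀ᶠ t : ℕ in atTop, ENNReal.ofReal (Real.exp (c - t * α)) ≤ p t) :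
    ((-α : ℝ) : EReal) ≤
      liminf (fun t : ℕ => (((1 : ℝ) / (t : ℝ) : ℝ) : EReal) * ENNReal.log (p t)) atTop := by
  have hlim : Tendsto (fun t : ℕ => ((c / t - α : ℝ) : EReal)) atTop (𝓝 ((-α : ℝ) : EReal)) := by
    refine EReal.tendsto_coe.2 ?_
    simpa using (tendsto_const_div_atTop_nhds_zero_nat c).sub_const α
  rw [← hlim.liminf_eq]
  refine liminf_le_liminf ?_
  filter_upwards [h, eventually_gt_atTop 0] with t ht ht0
  have ht0' : (0 : ℝ) < t := by exact_mod_cast ht0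
  calc _ = (((1 : ℝ) / (t : ℝ) : ℝ) : EReal)
          * ENNReal.log (ENNReal.ofReal (Real.exp (c - t * α))) := by
        rw [ENNReal.log_ofReal_of_pos (Real.exp_pos _), Real.log_exp, ← EReal.coe_mul]
        congr 1
        field_simp
    _ ≤ _ := mul_le_mul_of_nonneg_left (ENNReal.log_le_log ht)
          (EReal.coe_nonneg.2 (by positivity))

lemma lintegral_exp_sub (f : Ω → ℝ) (K : ℝ) :
    ∫⁻ ω, ENNReal.ofReal (Real.exp (f ω - K)) ∂μ =
      (∫⁻ ω, ENNReal.ofReal (Real.exp (f ω)) ∂μ) * ENNReal.ofReal (Real.exp (-K)) := by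
  simp_rw [sub_eq_add_neg, Real.exp_add, ENNReal.ofReal_mul (Real.exp_nonneg _)]
  exact lintegral_mul_const' _ _ ENNReal.ofReal_ne_top

/-- The exponential Chebyshev inequality for the measure with density `exp g`. -/
lemma withDensity_exp_le {f g : Ω → ℝ} (hf : Measurable f) {K c : ℝ}
    (h : ∫⁻ ω, ENNReal.ofReal (Real.exp (g ω + f ω)) ∂μ ≤ ENNReal.ofReal (Real.exp K)) :
    μ.withDensity (fun ω => ENNReal.ofReal (Real.exp (g ω))) {ω | c ≤ f ω} ≤
      ENNReal.ofReal (Real.exp (K - c)) := by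
  have hs : MeasurableSet {ω | c ≤ f ω} := measurableSet_le measurable_const hf
  rw [withDensity_apply _ hs]
  calc _ ≤ ∫⁻ ω in {ω | c ≤ f ω}, ENNReal.ofReal (Real.exp (g ω + f ω - c)) ∂μ := by
        refine setLIntegral_mono' hs fun ω hω => ?_
        have : c ≤ f ω := hω
        gcongr
        linarith
    _ ≤ ∫⁻ ω, ENNReal.ofReal (Real.exp (g ω + f ω - c)) ∂μ := setLIntegral_le_lintegral _ _
    _ ≤ _ := by
        rw [lintegral_exp_sub (fun ω => g ω + f ω), sub_eq_add_neg, Real.exp_add,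
          ENNReal.ofReal_mul (Real.exp_nonneg _)]
        gcongr

lemma norm_le_of_inner_basisFun_le {y : EuclideanSpace ℝ (Fin d)} {r : ℝ}
    (h : ∀ k, ⟪y, EuclideanSpace.basisFun (Fin d) ℝ k⟫ ≤ r)
    (h' : ∀ k, ⟪y, -EuclideanSpace.basisFun (Fin d) ℝ k⟫ ≤ r) : ‖y‖ ≤ d * r := by
  set b := EuclideanSpace.basisFun (Fin d) ℝ
  calc ‖y‖ = ‖∑ k, ⟪b k, y⟫ • b k‖ := by rw [b.sum_repr']
    _ ≤ ∑ k, ‖⟪b k, y⟫ • b k‖ := norm_sum_le _ _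
    _ ≤ ∑ _k : Fin d, r := by
        refine Finset.sum_le_sum fun k _ => ?_
        rw [norm_smul, b.norm_eq_one, mul_one, Real.norm_eq_abs, real_inner_comm, abs_le]
        have := h' k
        rw [inner_neg_right] at this
        exact ⟨by linarith, h k⟩
    _ = d * r := by simp

/-- A closed set that is covered by the open half-spaces `α < ⟪x, ξ⟫ - Λ(ξ)` is covered by finitely
many of them: the half-spaces in the directions of the coordinate axes leave only a bounded part of
the set uncovered. -/
lemma exists_finset_halfSpace_cover {Λ : EuclideanSpace ℝ (Fin d) → ℝ} {α : ℝ}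
    {F : Set (EuclideanSpace ℝ (Fin d))} (hF : IsClosed F)
    (hα : ∀ x ∈ F, ∃ ξ, α < ⟪x, ξ⟫ - Λ ξ) :
    ∃ T : Finset (EuclideanSpace ℝ (Fin d)), ∀ x ∈ F, ∃ ξ ∈ T, α < ⟪x, ξ⟫ - Λ ξ := by
  classical
  set b := EuclideanSpace.basisFun (Fin d) ℝ
  set H : EuclideanSpace ℝ (Fin d) → Set (EuclideanSpace ℝ (Fin d)) :=
    fun ξ => {x | α < ⟪x, ξ⟫ - Λ ξ}
  have hH (ξ) : IsOpen (H ξ) := isOpen_lt (by fun_prop) (by fun_prop)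
  set T₀ : Finset (EuclideanSpace ℝ (Fin d)) :=
    Finset.univ.image b ∪ Finset.univ.image (fun k => -b k)
  obtain ⟨R, hR⟩ : ∃ R, ∀ ξ ∈ T₀, α + Λ ξ ≤ R := by
    obtain ⟨R, hR⟩ := (T₀.image fun ξ => α + Λ ξ).bddAbove
    exact ⟨R, fun ξ hξ => hR (by exact_mod_cast Finset.mem_image_of_mem _ hξ)⟩
  have hK : IsCompact (F \ ⋃ ξ ∈ T₀, H ξ) := by
    refine Metric.isCompact_of_isClosed_isBounded
      (hF.sdiff (isOpen_biUnion fun ξ _ => hH ξ)) ?_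
    refine (Metric.isBounded_closedBall (x := 0) (r := d * R)).subset fun x hx => ?_
    have hx' : ∀ ξ ∈ T₀, ⟪x, ξ⟫ ≤ R := fun ξ hξ => by
      by_contra hlt
      refine hx.2 (Set.mem_biUnion hξ ?_)
      have := hR ξ hξ
      simp only [H, Set.mem_ofPred_eq]
      linarith
    rw [mem_closedBall_zero_iff]
    exact norm_le_of_inner_basisFun_le (fun k => hx' _ (by simp [T₀, b]))
      (fun k => hx' _ (by simp [T₀, b]))
  obtain ⟨T, hT⟩ := hK.elim_finite_subcover H hH fun x hx => by
    obtain ⟨ξ, hξ⟩ := hα x hx.1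
    exact Set.mem_iUnion.2 ⟨ξ, hξ⟩
  refine ⟨T₀ ∪ T, fun x hx => ?_⟩
  by_cases hx0 : x ∈ ⋃ ξ ∈ T₀, H ξ
  · obtain ⟨ξ, hξ, h⟩ := Set.mem_iUnion₂.1 hx0
    exact ⟨ξ, Finset.mem_union_left _ hξ, h⟩
  · obtain ⟨ξ, hξ, h⟩ := Set.mem_iUnion₂.1 (hT ⟨hx, hx0⟩)
    exact ⟨ξ, Finset.mem_union_right _ hξ, h⟩

/-- Upper bound for closed sets: each half-space of a finite cover is charged at most `exp (-t α)`
by the exponential Chebyshev inequality. -/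
lemma exists_measure_le_of_isClosed {X : ℕ → Ω → EuclideanSpace ℝ (Fin d)}
    (hX : ∀ t, Measurable (X t)) {Λ : EuclideanSpace ℝ (Fin d) → ℝ}
    (hmgf : ∀ ξ (t : ℕ), ∫⁻ ω, ENNReal.ofReal (Real.exp (t * ⟪ξ, X t ω⟫)) ∂μ ≤
      ENNReal.ofReal (Real.exp (t * Λ ξ)))
    {F : Set (EuclideanSpace ℝ (Fin d))} (hF : IsClosed F) {α : ℝ}
    (hα : ∀ x ∈ F, ∃ ξ, α < ⟪x, ξ⟫ - Λ ξ) :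
    ∃ c : ℝ, ∀ t : ℕ, μ {ω | X t ω ∈ F} ≤ ENNReal.ofReal (Real.exp (c - t * α)) := by
  obtain ⟨T, hT⟩ := exists_finset_halfSpace_cover hF hα
  refine ⟨(T.card : ℝ), fun t => ?_⟩
  have hhalf (ξ) : μ {ω | t * (α + Λ ξ) ≤ t * ⟪ξ, X t ω⟫} ≤
      ENNReal.ofReal (Real.exp (-(t * α))) := by
    have hm := hX t
    have h := withDensity_exp_le (μ := μ) (f := fun ω => t * ⟪ξ, X t ω⟫) (g := fun _ => 0)
      (K := t * Λ ξ) (c := t * (α + Λ ξ)) (by fun_prop) (by simpa using hmgf ξ t)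
    simp only [Real.exp_zero, ENNReal.ofReal_one] at h
    rw [show (fun _ : Ω => (1 : ℝ≥0∞)) = 1 from rfl, withDensity_one] at h
    refine h.trans (le_of_eq ?_)
    ring_nf
  calc μ {ω | X t ω ∈ F} ≤ μ (⋃ ξ ∈ T, {ω | t * (α + Λ ξ) ≤ t * ⟪ξ, X t ω⟫}) := by
        refine measure_mono fun ω hω => ?_
        obtain ⟨ξ, hξ, h⟩ := hT _ hω
        refine Set.mem_biUnion hξ ?_
        simp only [Set.mem_ofPred_eq]
        gcongr
        rw [real_inner_comm]
        linarith
    _ ≤ ∑ ξ ∈ T, μ {ω | t * (α + Λ ξ) ≤ t * ⟪ξ, X t ω⟫} := measure_biUnion_finset_le _ _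
    _ ≤ ∑ _ξ ∈ T, ENNReal.ofReal (Real.exp (-(t * α))) := Finset.sum_le_sum fun ξ _ => hhalf ξ
    _ = ENNReal.ofReal (T.card * Real.exp (-(t * α))) := by
        rw [Finset.sum_const, nsmul_eq_mul, ENNReal.ofReal_mul (Nat.cast_nonneg _),
          ENNReal.ofReal_natCast]
    _ ≤ _ := by
        rw [sub_eq_add_neg, Real.exp_add]
        gcongr
        linarith [Real.add_one_le_exp (T.card : ℝ)]

/-- If the derivative at `0` is smaller than `γ`, then so is some difference quotient. -/
lemma exists_pos_lt_of_hasDerivAt {φ : ℝ → ℝ} {D γ : ℝ} (h : HasDerivAt φ D 0) (hγ : D < γ) :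
    ∃ θ > 0, φ θ < φ 0 + θ * γ := by
  have h1 := (h.tendsto_slope_zero_right.eventually (eventually_lt_nhds hγ)).and
    self_mem_nhdsWithin
  obtain ⟨θ, hθ, hpos⟩ := h1.exists
  refine ⟨θ, hpos, ?_⟩
  have hpos' : 0 < θ := hpos
  rw [zero_add, smul_eq_mul, inv_mul_lt_iff₀ hpos'] at hθ
  linarith

lemma tendsto_ofReal_exp_mul_of_neg {κ : ℝ} (hκ : κ < 0) :
    Tendsto (fun t : ℕ => ENNReal.ofReal (Real.exp (t * κ))) atTop (𝓝 0) := by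
  rw [← ENNReal.ofReal_zero]
  refine ENNReal.tendsto_ofReal (Real.tendsto_exp_atBot.comp ?_)
  exact tendsto_natCast_atTop_atTop.atTop_mul_const_of_neg hκ

/-- Lower bound at a point `y` of the range of the gradient of `Λ`, by exponential tilting. Under
the law with density `exp (⟪η, S t⟫ - t N Λ(η))`, where `y = ∇Λ(η)`, the probability that `X t` lies
in a given half-space at a positive distance from `y` decays exponentially, and so does the
probability that `⟪η, S t⟫` is at least `t (N ⟪η, y⟫ + ρ)`. On the remaining event,
`X t` is close to `y` and the density is at most `exp (t (N (⟪y, η⟫ - Λ(η)) + ρ))`. -/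
lemma exists_le_measure_of_hasDerivAt {N : ℕ} {X S : ℕ → Ω → EuclideanSpace ℝ (Fin d)}
    (hX : ∀ t, Measurable (X t)) (hS : ∀ t, Measurable (S t))
    {Λ : EuclideanSpace ℝ (Fin d) → ℝ}
    (hmgfS : ∀ ζ (t : ℕ), ∫⁻ ω, ENNReal.ofReal (Real.exp ⟪ζ, S t ω⟫) ∂μ =
      ENNReal.ofReal (Real.exp (t * (N * Λ ζ))))
    (hmgf : ∀ η ξ (t : ℕ), ∫⁻ ω, ENNReal.ofReal (Real.exp (⟪η, S t ω⟫ + t * ⟪ξ, X t ω⟫)) ∂μ ≤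
      ENNReal.ofReal (Real.exp (t * (N * Λ η + (Λ (η + ξ) - Λ η)))))
    {y η : EuclideanSpace ℝ (Fin d)}
    (hy : ∀ ξ, HasDerivAt (fun θ : ℝ => Λ (η + θ • ξ)) ⟪y, ξ⟫ 0)
    {U : Set (EuclideanSpace ℝ (Fin d))} (hU : U ∈ 𝓝 y) {ρ : ℝ} (hρ : 0 < ρ) :
    ∃ c : ℝ, ∀ᶠ t : ℕ in atTop,
      ENNReal.ofReal (Real.exp (c - t * (N * (⟪y, η⟫ - Λ η) + ρ))) ≤ μ {ω | X t ω ∈ U} := by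
  obtain ⟨δ, hδ, hδU⟩ := Metric.mem_nhds_iff.1 hU
  set b := EuclideanSpace.basisFun (Fin d) ℝ
  set g : ℕ → Ω → ℝ := fun t ω => ⟪η, S t ω⟫ - t * (N * Λ η) with hg
  have hgm (t) : Measurable (g t) := by
    have := hS t
    fun_prop
  set m : ℕ → Measure Ω :=
    fun t => μ.withDensity (fun ω => ENNReal.ofReal (Real.exp (g t ω))) with hm
  have hm1 (t) : m t Set.univ = 1 := by
    rw [hm, withDensity_apply _ MeasurableSet.univ, setLIntegral_univ]
    simp only [hg]
    rw [lintegral_exp_sub, hmgfS, ← ENNReal.ofReal_mul (Real.exp_nonneg _), ← Real.exp_add]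
    simp
  -- a half-space in direction `u` is tested with the exponent `θ • u`, where `θ` is so small that
  -- `Λ (η + θ • u) - Λ(η)` is close to its linearization `θ ⟪y, u⟫`
  have hXbad (u : EuclideanSpace ℝ (Fin d)) {γ : ℝ} (hγ : 0 < γ) :
      Tendsto (fun t => m t {ω | γ ≤ ⟪u, X t ω - y⟫}) atTop (𝓝 0) := by
    obtain ⟨θ, hθ, hlt⟩ := exists_pos_lt_of_hasDerivAt (hy u) (lt_add_of_pos_right ⟪y, u⟫ hγ)
    rw [zero_smul, add_zero] at hlt
    refine tendsto_of_tendsto_of_tendsto_of_le_of_le tendsto_const_nhds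
      (tendsto_ofReal_exp_mul_of_neg
        (κ := Λ (η + θ • u) - Λ η - θ * (⟪y, u⟫ + γ)) (by linarith))
      (fun _ => zero_le) fun t => ?_
    have hXt := hX t
    have h := withDensity_exp_le (μ := μ) (g := g t) (f := fun ω => t * ⟪θ • u, X t ω⟫)
      (K := t * (Λ (η + θ • u) - Λ η)) (c := t * (θ * (⟪y, u⟫ + γ))) (by fun_prop) (by
        have h := hmgf η (θ • u) t
        have h' : ∀ ω, g t ω + t * ⟪θ • u, X t ω⟫ =
            (⟪η, S t ω⟫ + t * ⟪θ • u, X t ω⟫) - t * (N * Λ η) := fun ω => by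
          simp only [hg]; ring
        simp_rw [h']
        rw [lintegral_exp_sub (fun ω => ⟪η, S t ω⟫ + t * ⟪θ • u, X t ω⟫)]
        refine (mul_le_mul_left h _).trans (le_of_eq ?_)
        rw [← ENNReal.ofReal_mul (Real.exp_nonneg _), ← Real.exp_add]
        ring_nf)
    refine (measure_mono fun ω hω => ?_).trans (h.trans (le_of_eq (by ring_nf)))
    have hω' : γ ≤ ⟪u, X t ω - y⟫ := hω
    rw [inner_sub_right, real_inner_comm y u] at hω'
    simp only [Set.mem_ofPred_eq, real_inner_smul_left]
    gcongr
    linarith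
  -- `⟪η, S t⟫` is tested in the same way, with the exponent `θ • η`
  have hSbad : Tendsto (fun t => m t {ω | t * (N * ⟪y, η⟫ + ρ) ≤ ⟪η, S t ω⟫}) atTop (𝓝 0) := by
    obtain ⟨θ, hθ, hlt⟩ := exists_pos_lt_of_hasDerivAt ((hy η).const_mul (N : ℝ))
      (lt_add_of_pos_right (N * ⟪y, η⟫) hρ)
    rw [zero_smul, add_zero] at hlt
    refine tendsto_of_tendsto_of_tendsto_of_le_of_le tendsto_const_nhds
      (tendsto_ofReal_exp_mul_of_neg
        (κ := N * Λ (η + θ • η) - N * Λ η - θ * (N * ⟪y, η⟫ + ρ)) (by linarith))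
      (fun _ => zero_le) fun t => ?_
    have hSt := hS t
    have h := withDensity_exp_le (μ := μ) (g := g t) (f := fun ω => ⟪θ • η, S t ω⟫)
      (K := t * (N * Λ (η + θ • η) - N * Λ η)) (c := t * (θ * (N * ⟪y, η⟫ + ρ)))
      (by fun_prop) (by
        have h := hmgfS (η + θ • η) t
        have h' : ∀ ω, g t ω + ⟪θ • η, S t ω⟫ = ⟪η + θ • η, S t ω⟫ - t * (N * Λ η) := fun ω => by
          simp only [hg, inner_add_left]; ring
        simp_rw [h']
        rw [lintegral_exp_sub (fun ω => ⟪η + θ • η, S t ω⟫), h,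
          ← ENNReal.ofReal_mul (Real.exp_nonneg _), ← Real.exp_add]
        refine le_of_eq ?_
        ring_nf)
    refine (measure_mono fun ω hω => ?_).trans (h.trans (le_of_eq (by ring_nf)))
    have hω' : t * (N * ⟪y, η⟫ + ρ) ≤ ⟪η, S t ω⟫ := hω
    simp only [Set.mem_ofPred_eq, real_inner_smul_left]
    nlinarith
  set γ : ℝ := δ / (d + 1) with hγdef
  have hγ : 0 < γ := by positivity
  have hdγ : d * γ < δ := by
    rw [hγdef, mul_div_assoc', div_lt_iff₀ (by positivity)]
    nlinarith
  have hbad : Tendsto (fun t => m t {ω | t * (N * ⟪y, η⟫ + ρ) ≤ ⟪η, S t ω⟫}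
      + ∑ k, (m t {ω | γ ≤ ⟪b k, X t ω - y⟫} + m t {ω | γ ≤ ⟪-b k, X t ω - y⟫}))
      atTop (𝓝 0) := by
    have := hSbad.add (tendsto_finsetSum (Finset.univ : Finset (Fin d)) fun k _ =>
      (hXbad (b k) hγ).add (hXbad (-b k) hγ))
    simpa using this
  refine ⟨Real.log 2⁻¹, ?_⟩
  filter_upwards [hbad.eventually_le_const (u := 2⁻¹) (by simp)] with t ht
  set A : Set Ω := {ω | X t ω ∈ Metric.ball y δ} ∩ {ω | ⟪η, S t ω⟫ < t * (N * ⟪y, η⟫ + ρ)}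
  have hXt := hX t
  have hSt := hS t
  have hA : MeasurableSet A :=
    (hXt Metric.isOpen_ball.measurableSet).inter (measurableSet_lt (by fun_prop) (by fun_prop))
  have hcover : (Set.univ : Set Ω) ⊆ A ∪ ({ω | t * (N * ⟪y, η⟫ + ρ) ≤ ⟪η, S t ω⟫} ∪
      ⋃ k ∈ (Finset.univ : Finset (Fin d)),
        ({ω | γ ≤ ⟪b k, X t ω - y⟫} ∪ {ω | γ ≤ ⟪-b k, X t ω - y⟫})) := by
    intro ω _
    by_contra hω
    simp only [Set.mem_union, Set.mem_iUnion, Set.mem_ofPred_eq, Finset.mem_univ, exists_true_left,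
      not_or, not_exists, not_le] at hω
    obtain ⟨h1, h2, h3⟩ := hω
    refine h1 ⟨?_, h2⟩
    simp only [Set.mem_ofPred_eq, Metric.mem_ball, dist_eq_norm]
    refine (norm_le_of_inner_basisFun_le (r := γ) (fun k => ?_) fun k => ?_).trans_lt hdγ
    · rw [real_inner_comm]
      exact (h3 k).1.le
    · rw [real_inner_comm]
      exact (h3 k).2.le
  have hmA : (2⁻¹ : ℝ≥0∞) ≤ m t A := by
    have h1 : (1 : ℝ≥0∞) ≤ m t A + 2⁻¹ := by
      rw [← hm1 t]
      refine (measure_mono hcover).trans ((measure_union_le _ _).trans ?_)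
      gcongr
      refine (measure_union_le _ _).trans (le_trans ?_ ht)
      gcongr
      exact (measure_biUnion_finset_le _ _).trans
        (Finset.sum_le_sum fun k _ => measure_union_le _ _)
    rw [← ENNReal.inv_two_add_inv_two] at h1
    exact (ENNReal.add_le_add_iff_right (by simp)).1 h1
  have hmA' : m t A ≤
      ENNReal.ofReal (Real.exp (t * (N * (⟪y, η⟫ - Λ η) + ρ))) * μ {ω | X t ω ∈ U} := by
    calc m t A = ∫⁻ ω in A, ENNReal.ofReal (Real.exp (g t ω)) ∂μ := withDensity_apply _ hA
      _ ≤ ∫⁻ _ω in A, ENNReal.ofReal (Real.exp (t * (N * (⟪y, η⟫ - Λ η) + ρ))) ∂μ := by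
          refine setLIntegral_mono' hA fun ω hω => ?_
          have : ⟪η, S t ω⟫ < t * (N * ⟪y, η⟫ + ρ) := hω.2
          gcongr
          simp only [hg]
          linarith
      _ = ENNReal.ofReal (Real.exp (t * (N * (⟪y, η⟫ - Λ η) + ρ))) * μ A :=
          setLIntegral_const _ _
      _ ≤ _ := by
          gcongr
          exact fun ω hω => hδU hω.1
  have hhalf : ENNReal.ofReal (Real.exp (Real.log 2⁻¹)) = 2⁻¹ := by
    rw [Real.exp_log (by norm_num), ENNReal.ofReal_inv_of_pos (by norm_num)]
    simp
  rw [sub_eq_add_neg, Real.exp_add, ENNReal.ofReal_mul (Real.exp_nonneg _), hhalf, Real.exp_neg,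
    ENNReal.ofReal_inv_of_pos (Real.exp_pos _), ← div_eq_mul_inv]
  refine ENNReal.div_le_of_le_mul' (hmA.trans hmA')

end LargeDeviations

/-! ### The states of the network -/

section State

variable {N : ℕ}

/-- Only the weights and the observations at times `t ≥ 1` enter the states. -/
lemma state_congr {w w' : ℕ → Matrix (Fin N) (Fin N) ℝ}
    {z z' : Fin N → ℕ → EuclideanSpace ℝ (Fin d)} (hw : ∀ s, w (s + 1) = w' (s + 1))
    (hz : ∀ j s, z j (s + 1) = z' j (s + 1)) (t : ℕ) : state w z t = state w' z' t := by
  induction t with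
  | zero => rfl
  | succ t ih => simp only [state, ih, hw, hz]

/-- The scaled state `t X_{i,t}` is a combination of the observations with nonnegative weights
(the entries of the products of the weight matrices) that sum to one over the nodes, at each
time. -/
lemma exists_weights_state {w : ℕ → Matrix (Fin N) (Fin N) ℝ}
    (hw : ∀ s, w (s + 1) ∈ Matrix.rowStochastic ℝ (Fin N)) (t : ℕ) (i : Fin N) :
    ∃ a : ℕ → Fin N → ℝ, (∀ s j, 0 ≤ a s j) ∧ (∀ s < t, ∑ j, a s j = 1) ∧
      ∀ z : Fin N → ℕ → EuclideanSpace ℝ (Fin d),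
        (t : ℝ) • state w z t i = ∑ s ∈ Finset.range t, ∑ j, a s j • z j (s + 1) := by
  induction t generalizing i with
  | zero => exact ⟨fun _ _ => 0, by simp⟩
  | succ t ih =>
    choose a ha0 ha1 ha using ih
    obtain ⟨hw0, hw1⟩ := Matrix.mem_rowStochastic_iff_sum.1 (hw t)
    refine ⟨fun s j => if s = t then w (t + 1) i j else ∑ k, w (t + 1) i k * a k s j,
      fun s j => ?_, fun s hs => ?_, fun z => ?_⟩
    · beta_reduce
      split_ifs
      · exact hw0 i j
      · exact Finset.sum_nonneg fun k _ => mul_nonneg (hw0 i k) (ha0 k s j)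
    · beta_reduce
      split_ifs with h
      · exact hw1 i
      · rw [Finset.sum_comm]
        simp_rw [← Finset.mul_sum]
        rw [Finset.sum_congr rfl fun k _ => by rw [ha1 k s (by omega), mul_one], hw1]
    · have ht : (t : ℝ) + 1 ≠ 0 := by positivity
      have hlast : ∀ s ∈ Finset.range t, ∑ j, (if s = t then w (t + 1) i j
          else ∑ k, w (t + 1) i k * a k s j) • z j (s + 1) =
            ∑ k, w (t + 1) i k • ∑ j, a k s j • z j (s + 1) := fun s hs => by
        simp_rw [if_neg (Finset.mem_range.1 hs).ne, Finset.sum_smul, Finset.smul_sum, smul_smul]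
        rw [Finset.sum_comm]
      rw [Finset.sum_range_succ, Finset.sum_congr rfl hlast, Finset.sum_comm]
      simp_rw [← Finset.smul_sum, ← ha]
      simp only [state, if_true]
      rw [Finset.smul_sum, ← Finset.sum_add_distrib]
      refine Finset.sum_congr rfl fun j _ => ?_
      rw [← smul_add, smul_comm, smul_add, smul_smul, smul_smul]
      push_cast
      rw [mul_div_cancel₀ _ ht, mul_one_div_cancel ht, one_smul]

lemma measurable_state {Ω : Type*} [MeasurableSpace Ω] {W : ℕ → Ω → Matrix (Fin N) (Fin N) ℝ}
    {Z : Fin N → ℕ → Ω → EuclideanSpace ℝ (Fin d)}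
    (hW : ∀ s i j, Measurable fun ω => W (s + 1) ω i j) (hZ : ∀ j s, Measurable (Z j (s + 1)))
    (t : ℕ) (i : Fin N) :
    Measurable fun ω => state (fun s => W s ω) (fun j s => Z j s ω) t i := by
  induction t generalizing i with
  | zero => exact measurable_const
  | succ t ih =>
    simp only [state]
    fun_prop

end State

section MGF

variable {Ω : Type*} [MeasurableSpace Ω] {μ : Measure Ω} {N : ℕ}
  {ν : Measure (EuclideanSpace ℝ (Fin d))} [IsProbabilityMeasure ν]

lemma lintegral_exp_sum_inner {Z : Fin N → ℕ → Ω → EuclideanSpace ℝ (Fin d)}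
    (hν : ∀ ξ, Integrable (fun x => Real.exp ⟪ξ, x⟫) ν)
    (hZmeas : ∀ j s, Measurable (Z j (s + 1))) (hZlaw : ∀ j s, μ.map (Z j (s + 1)) = ν)
    (hZindep : iIndepFun (fun p : Fin N × ℕ => Z p.1 (p.2 + 1)) μ)
    (ζ : ℕ → Fin N → EuclideanSpace ℝ (Fin d)) (t : ℕ) :
    ∫⁻ ω, ENNReal.ofReal (Real.exp (∑ s ∈ Finset.range t, ∑ j, ⟪ζ s j, Z j (s + 1) ω⟫)) ∂μ =
      ENNReal.ofReal (Real.exp (∑ s ∈ Finset.range t, ∑ j, cumulant ν (ζ s j))) := by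
  have hprod (f : ℕ → Fin N → ℝ) :
      ENNReal.ofReal (Real.exp (∑ s ∈ Finset.range t, ∑ j, f s j)) =
        ∏ p ∈ (Finset.univ : Finset (Fin N)) ×ˢ Finset.range t,
          ENNReal.ofReal (Real.exp (f p.2 p.1)) := by
    rw [Finset.sum_comm, ← Finset.sum_product', Real.exp_sum,
      ENNReal.ofReal_prod_of_nonneg fun _ _ => Real.exp_nonneg _]
  simp_rw [hprod]
  have hexp (p : Fin N × ℕ) :
      Measurable fun x : EuclideanSpace ℝ (Fin d) => ENNReal.ofReal (Real.exp ⟪ζ p.2 p.1, x⟫) := by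
    fun_prop
  refine (lintegral_prod_eq_prod_lintegral_of_indepFun _ _
    (hZindep.comp (fun p x => ENNReal.ofReal (Real.exp ⟪ζ p.2 p.1, x⟫)) hexp)
    fun p => (hexp p).comp (hZmeas p.1 p.2)).trans ?_
  refine Finset.prod_congr rfl fun p _ => ?_
  rw [← lintegral_exp_inner (hν _), ← hZlaw p.1 p.2, lintegral_map (hexp p) (hZmeas p.1 p.2)]
  rfl

/-- For deterministic weights, the exponent is a sum of terms `⟪η + a • ξ, Z⟫` with independent `Z`
and `a ∈ [0, 1]`. Convexity bounds each cumulant by `(1 - a) Λ(η) + a Λ(η + ξ)`, and the weights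
`a` add up to `t`. -/
lemma lintegral_exp_state_le_of_deterministic {Z : Fin N → ℕ → Ω → EuclideanSpace ℝ (Fin d)}
    (hν : ∀ ξ, Integrable (fun x => Real.exp ⟪ξ, x⟫) ν)
    (hZmeas : ∀ j s, Measurable (Z j (s + 1))) (hZlaw : ∀ j s, μ.map (Z j (s + 1)) = ν)
    (hZindep : iIndepFun (fun p : Fin N × ℕ => Z p.1 (p.2 + 1)) μ)
    {w : ℕ → Matrix (Fin N) (Fin N) ℝ}
    (hw : ∀ s, w (s + 1) ∈ Matrix.rowStochastic ℝ (Fin N))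
    (η ξ : EuclideanSpace ℝ (Fin d)) (t : ℕ) (i : Fin N) :
    ∫⁻ ω, ENNReal.ofReal (Real.exp (⟪η, ∑ s ∈ Finset.range t, ∑ j, Z j (s + 1) ω⟫
        + t * ⟪ξ, state w (fun j s => Z j s ω) t i⟫)) ∂μ ≤
      ENNReal.ofReal (Real.exp
        (t * (N * cumulant ν η + (cumulant ν (η + ξ) - cumulant ν η)))) := by
  obtain ⟨a, ha0, ha1, ha⟩ := exists_weights_state (d := d) hw t i
  have hsum (ω : Ω) : ⟪η, ∑ s ∈ Finset.range t, ∑ j, Z j (s + 1) ω⟫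
      + t * ⟪ξ, state w (fun j s => Z j s ω) t i⟫ =
        ∑ s ∈ Finset.range t, ∑ j, ⟪η + a s j • ξ, Z j (s + 1) ω⟫ := by
    rw [← real_inner_smul_right, ha]
    simp_rw [inner_sum, inner_add_left, real_inner_smul_left, real_inner_smul_right,
      Finset.sum_add_distrib]
  simp_rw [hsum]
  rw [lintegral_exp_sum_inner hν hZmeas hZlaw hZindep fun s j => η + a s j • ξ]
  gcongr
  calc ∑ s ∈ Finset.range t, ∑ j, cumulant ν (η + a s j • ξ)
      ≤ ∑ s ∈ Finset.range t, ∑ j,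
          (cumulant ν η + a s j * (cumulant ν (η + ξ) - cumulant ν η)) := by
        refine Finset.sum_le_sum fun s hs => Finset.sum_le_sum fun j _ => ?_
        have hle : a s j ≤ 1 := by
          rw [← ha1 s (Finset.mem_range.1 hs)]
          exact Finset.single_le_sum (fun k _ => ha0 s k) (Finset.mem_univ j)
        have h := (convexOn_cumulant hν).2 (Set.mem_univ η) (Set.mem_univ (η + ξ))
          (sub_nonneg.2 hle) (ha0 s j) (sub_add_cancel 1 _)
        rw [show (1 - a s j) • η + a s j • (η + ξ) = η + a s j • ξ by module] at h
        simp only [smul_eq_mul] at h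
        linarith
    _ = ∑ s ∈ Finset.range t, (N * cumulant ν η + (cumulant ν (η + ξ) - cumulant ν η)) := by
        refine Finset.sum_congr rfl fun s hs => ?_
        rw [Finset.sum_add_distrib, ← Finset.sum_mul, ha1 s (Finset.mem_range.1 hs)]
        simp
    _ = _ := by rw [Finset.sum_const, Finset.card_range, nsmul_eq_mul]

/-- The bound for deterministic weights does not depend on the weights, so that it passes to random
weights independent of the observations by conditioning on them, that is, by Tonelli's theorem for
the product law of weights and observations. -/
lemma lintegral_exp_state_le [IsProbabilityMeasure μ]
    {W : ℕ → Ω → Matrix (Fin N) (Fin N) ℝ} {Z : Fin N → ℕ → Ω → EuclideanSpace ℝ (Fin d)}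
    (hν : ∀ ξ, Integrable (fun x => Real.exp ⟪ξ, x⟫) ν)
    (hWmeas : ∀ s i j, Measurable fun ω => W (s + 1) ω i j)
    (hWstoch : ∀ s, ∀ᵐ ω ∂μ, W (s + 1) ω ∈ Matrix.rowStochastic ℝ (Fin N))
    (hZmeas : ∀ j s, Measurable (Z j (s + 1))) (hZlaw : ∀ j s, μ.map (Z j (s + 1)) = ν)
    (hZindep : iIndepFun (fun p : Fin N × ℕ => Z p.1 (p.2 + 1)) μ)
    (hWZ : IndepFun (fun ω (q : ℕ × Fin N × Fin N) => W (q.1 + 1) ω q.2.1 q.2.2)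
      (fun ω (p : Fin N × ℕ) => Z p.1 (p.2 + 1) ω) μ)
    (η ξ : EuclideanSpace ℝ (Fin d)) (t : ℕ) (i : Fin N) :
    ∫⁻ ω, ENNReal.ofReal (Real.exp (⟪η, ∑ s ∈ Finset.range t, ∑ j, Z j (s + 1) ω⟫
        + t * ⟪ξ, state (fun s => W s ω) (fun j s => Z j s ω) t i⟫)) ∂μ ≤
      ENNReal.ofReal (Real.exp
        (t * (N * cumulant ν η + (cumulant ν (η + ξ) - cumulant ν η)))) := by
  set w : Ω → (ℕ × Fin N × Fin N → ℝ) := fun ω q => W (q.1 + 1) ω q.2.1 q.2.2 with hwdef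
  set z : Ω → (Fin N × ℕ → EuclideanSpace ℝ (Fin d)) := fun ω p => Z p.1 (p.2 + 1) ω with hzdef
  have hw : Measurable w := measurable_pi_lambda _ fun q => hWmeas _ _ _
  have hz : Measurable z := measurable_pi_lambda _ fun p => hZmeas _ _
  -- weights and observations, with their times shifted by one, as functions of their joint values
  set Ws : ℕ → (ℕ × Fin N × Fin N → ℝ) → Matrix (Fin N) (Fin N) ℝ :=
    fun s v => Matrix.of fun k l => v (s - 1, k, l) with hWs
  set Zs : Fin N → ℕ → (Fin N × ℕ → EuclideanSpace ℝ (Fin d)) → EuclideanSpace ℝ (Fin d) :=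
    fun j s v => v (j, s - 1) with hZs
  set φ : (ℕ × Fin N × Fin N → ℝ) × (Fin N × ℕ → EuclideanSpace ℝ (Fin d)) → ℝ≥0∞ :=
    fun v => ENNReal.ofReal (Real.exp (⟪η, ∑ s ∈ Finset.range t, ∑ j, v.2 (j, s)⟫
      + t * ⟪ξ, state (fun s => Ws s v.1) (fun j s => Zs j s v.2) t i⟫)) with hφdef
  have hφ : Measurable φ := by
    have := measurable_state (W := fun s (v : (ℕ × Fin N × Fin N → ℝ) ×
      (Fin N × ℕ → EuclideanSpace ℝ (Fin d))) => Ws s v.1) (Z := fun j s v => Zs j s v.2)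
      (fun s k l => by simp only [hWs, Matrix.of_apply]; fun_prop)
      (fun j s => by simp only [hZs]; fun_prop) t i
    fun_prop
  have hφZ (v : ℕ × Fin N × Fin N → ℝ) (ω : Ω) : φ (v, z ω) =
      ENNReal.ofReal (Real.exp (⟪η, ∑ s ∈ Finset.range t, ∑ j, Z j (s + 1) ω⟫
        + t * ⟪ξ, state (fun s => Ws s v) (fun j s => Z j s ω) t i⟫)) := by
    simp only [hφdef]
    rw [state_congr (w' := fun s => Ws s v) (z' := fun j s => Z j s ω) (fun _ => rfl)
      fun j s => by simp [hZs, hzdef]]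
  have hstoch : ∀ᵐ v ∂μ.map w, ∀ s, Ws (s + 1) v ∈ Matrix.rowStochastic ℝ (Fin N) := by
    have hms : MeasurableSet
        {v | ∀ s, Ws (s + 1) v ∈ Matrix.rowStochastic ℝ (Fin N)} := by
      simp only [Matrix.mem_rowStochastic_iff_sum, hWs, Matrix.of_apply]
      refine measurableSet_setOfPred.2 (Measurable.forall fun s => Measurable.and
        (Measurable.forall fun k => Measurable.forall fun l => ?_)
        (Measurable.forall fun k => ?_))
      · exact measurableSet_setOfPred.1 (measurableSet_le measurable_const (by fun_prop))
      · exact measurableSet_setOfPred.1 (measurableSet_eq_fun (by fun_prop) measurable_const)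
    rw [ae_map_iff hw.aemeasurable hms]
    filter_upwards [ae_all_iff.2 hWstoch] with ω hω s
    exact hω s
  calc _ = ∫⁻ ω, φ (w ω, z ω) ∂μ := by
        refine lintegral_congr fun ω => ?_
        rw [hφZ]
        rw [state_congr (w' := fun s => Ws s (w ω)) (z' := fun j s => Z j s ω)
          (fun s => by ext k l; simp [hWs, hwdef]) fun _ _ => rfl]
    _ = ∫⁻ v, φ v ∂((μ.map w).prod (μ.map z)) := by
        rw [← (indepFun_iff_map_prod_eq_prod_map_map hw.aemeasurable hz.aemeasurable).1 hWZ,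
          lintegral_map hφ (hw.prodMk hz)]
    _ = ∫⁻ v, ∫⁻ u, φ (v, u) ∂μ.map z ∂μ.map w := lintegral_prod _ hφ.aemeasurable
    _ ≤ ∫⁻ _v, ENNReal.ofReal (Real.exp
        (t * (N * cumulant ν η + (cumulant ν (η + ξ) - cumulant ν η)))) ∂μ.map w := by
        refine lintegral_mono_ae ?_
        filter_upwards [hstoch] with v hv
        rw [lintegral_map (by fun_prop) hz]
        simp_rw [hφZ]
        exact lintegral_exp_state_le_of_deterministic hν hZmeas hZlaw hZindep hv η ξ t i
    _ = _ := by
        have := Measure.isProbabilityMeasure_map (μ := μ) hw.aemeasurable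
        simp

end MGF

/-! ### Rate functions and the large deviation bounds -/

section Rate

variable {Ω : Type*} [MeasurableSpace Ω] {μ : Measure Ω}
  {Y : Ω → EuclideanSpace ℝ (Fin d)}

lemma integrable_exp_inner_of_logMGF_lt_top (hY : Measurable Y) {ξ : EuclideanSpace ℝ (Fin d)}
    (h : logMGF μ Y ξ < ⊤) : Integrable (fun x => Real.exp ⟪ξ, x⟫) (μ.map Y) := by
  rw [logMGF, ENNReal.log_lt_top_iff] at h
  refine (integrable_map_measure (by fun_prop) hY.aemeasurable).2 ?_
  exact (lintegral_ofReal_ne_top_iff_integrable (by fun_prop)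
    (ae_of_all _ fun _ => Real.exp_nonneg _)).1 h.ne

lemma rateFunction_eq_iSup_cumulant [IsProbabilityMeasure μ] (hY : Measurable Y)
    (h : ∀ ξ, logMGF μ Y ξ < ⊤) (x : EuclideanSpace ℝ (Fin d)) :
    rateFunction μ Y x = ⨆ ξ, ((⟪x, ξ⟫ - cumulant (μ.map Y) ξ : ℝ) : EReal) := by
  have := Measure.isProbabilityMeasure_map (μ := μ) hY.aemeasurable
  have hlog (ξ) : logMGF μ Y ξ = (cumulant (μ.map Y) ξ : EReal) := by
    have h1 := lintegral_exp_inner (integrable_exp_inner_of_logMGF_lt_top hY (h ξ))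
    rw [lintegral_map (by fun_prop) hY] at h1
    rw [logMGF, h1, ENNReal.log_ofReal_of_pos (Real.exp_pos _), Real.log_exp]
  simp_rw [rateFunction, conjugate, hlog, EReal.coe_sub]

end Rate

end DistributedInference

open DistributedInference in
theorem theorem3 {Ω : Type*} [MeasurableSpace Ω] (μ : Measure Ω) [IsProbabilityMeasure μ]
    (N d : ℕ)
    (W : ℕ → Ω → Matrix (Fin N) (Fin N) ℝ)
    (Z : Fin N → ℕ → Ω → EuclideanSpace ℝ (Fin d))
    (hWmeas : ∀ t, 1 ≤ t → ∀ i j, Measurable (fun ω => W t ω i j))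
    (hWstoch : ∀ t, 1 ≤ t → ∀ᵐ ω ∂μ, W t ω ∈ Matrix.rowStochastic ℝ (Fin N))
    (hZmeas : ∀ i t, 1 ≤ t → Measurable (Z i t))
    (hZindep : iIndepFun (fun (p : Fin N × ℕ) => Z p.1 (p.2 + 1)) μ)
    (hZident : ∀ i j s t, 1 ≤ s → 1 ≤ t → IdentDistrib (Z i s) (Z j t) μ μ)
    (hWZ : IndepFun (fun ω (q : ℕ × Fin N × Fin N) => W (q.1 + 1) ω q.2.1 q.2.2)
      (fun ω (p : Fin N × ℕ) => Z p.1 (p.2 + 1) ω) μ)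
    (hfin : ∀ i t, 1 ≤ t → ∀ ξ, DistributedInference.logMGF μ (Z i t) ξ < ⊤)
    (i : Fin N) (G : Set (EuclideanSpace ℝ (Fin d))) (hG : MeasurableSet G) :
    - (⨅ x ∈ interior G, (N : EReal) * DistributedInference.rateFunction μ (Z i 1) x) ≤
        liminf (DistributedInference.logProb μ W Z i G) atTop ∧
      liminf (DistributedInference.logProb μ W Z i G) atTop ≤
        limsup (DistributedInference.logProb μ W Z i G) atTop ∧
      limsup (DistributedInference.logProb μ W Z i G) atTop ≤
        - (⨅ x ∈ closure G, DistributedInference.rateFunction μ (Z i 1) x) := by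
  have hZ1 : Measurable (Z i 1) := hZmeas i 1 le_rfl
  set ν := μ.map (Z i 1)
  have : IsProbabilityMeasure ν := Measure.isProbabilityMeasure_map hZ1.aemeasurable
  have hν (ξ) : Integrable (fun x => Real.exp (inner ℝ ξ x)) ν :=
    integrable_exp_inner_of_logMGF_lt_top hZ1 (hfin i 1 le_rfl ξ)
  have hrate := rateFunction_eq_iSup_cumulant hZ1 (hfin i 1 le_rfl)
  have hZmeas' (j s) : Measurable (Z j (s + 1)) := hZmeas j (s + 1) (by omega)
  have hWmeas' (s k l) : Measurable fun ω => W (s + 1) ω k l := hWmeas (s + 1) (by omega) k l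
  have hZlaw (j s) : μ.map (Z j (s + 1)) = ν := (hZident j i (s + 1) 1 (by omega) le_rfl).map_eq
  set X : ℕ → Ω → EuclideanSpace ℝ (Fin d) :=
    fun t ω => state (fun s => W s ω) (fun j s => Z j s ω) t i
  set S : ℕ → Ω → EuclideanSpace ℝ (Fin d) :=
    fun t ω => ∑ s ∈ Finset.range t, ∑ j, Z j (s + 1) ω with hSdef
  have hX (t) : Measurable (X t) := measurable_state hWmeas' hZmeas' t i
  have hS (t) : Measurable (S t) := by fun_prop
  have hmgf := fun η ξ t => lintegral_exp_state_le hν hWmeas'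
    (fun s => hWstoch (s + 1) (by omega)) hZmeas' hZlaw hZindep hWZ η ξ t i
  refine ⟨?_, liminf_le_limsup, ?_⟩
  · rw [EReal.neg_le]
    refine le_iInf₂ fun x hx => ?_
    rw [EReal.neg_le]
    by_cases htop : rateFunction μ (Z i 1) x = ⊤
    · rw [htop, EReal.mul_top_of_pos (by exact_mod_cast i.pos)]
      simp
    -- the rate at `x` is a real number `v`, since its supremum includes the value `0` at `0`
    obtain ⟨v, hv⟩ : ∃ v : ℝ, rateFunction μ (Z i 1) x = v := by
      refine ⟨_, (EReal.coe_toReal htop fun hbot => ?_).symm⟩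
      have := le_iSup (fun ξ => ((inner ℝ x ξ - cumulant ν ξ : ℝ) : EReal)) 0
      rw [← hrate, hbot] at this
      simp at this
    have hle (ξ) : inner ℝ x ξ - cumulant ν ξ ≤ v := by
      rw [← EReal.coe_le_coe_iff, ← hv, hrate]
      exact le_iSup (fun ξ => ((inner ℝ x ξ - cumulant ν ξ : ℝ) : EReal)) ξ
    obtain ⟨y, hy, η, hyv, hder⟩ := exists_gradient_mem hν hle (isOpen_interior.mem_nhds hx)
    have hmgfS (ζ) (t : ℕ) : ∫⁻ ω, ENNReal.ofReal (Real.exp (inner ℝ ζ (S t ω))) ∂μ =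
        ENNReal.ofReal (Real.exp (t * (N * cumulant ν ζ))) := by
      simpa [hSdef, inner_sum] using
        lintegral_exp_sum_inner hν hZmeas' hZlaw hZindep (fun _ _ => ζ) t
    rw [hv]
    refine EReal.ge_of_forall_gt_iff_ge.1 fun a ha => ?_
    have ha' : a < -(N * v) := by exact_mod_cast ha
    obtain ⟨c, hc⟩ := exists_le_measure_of_hasDerivAt (N := N) hX hS hmgfS hmgf hder
      (mem_interior_iff_mem_nhds.1 hy) (ρ := -(N * v) - a) (by linarith)
    refine le_trans ?_ (le_liminf_log hc)
    have := mul_le_mul_of_nonneg_left hyv (Nat.cast_nonneg (α := ℝ) N)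
    exact_mod_cast (by linarith)
  · rw [EReal.le_neg]
    refine EReal.ge_of_forall_gt_iff_ge.1 fun a ha => ?_
    have hcover : ∀ x ∈ closure G, ∃ ξ, a < inner ℝ x ξ - cumulant ν ξ := fun x hx => by
      have h := ha.trans_le (iInf₂_le x hx)
      rw [hrate] at h
      obtain ⟨ξ, hξ⟩ := lt_iSup_iff.1 h
      exact ⟨ξ, by exact_mod_cast hξ⟩
    obtain ⟨c, hc⟩ := exists_measure_le_of_isClosed hX
      (fun ξ t => by simpa [cumulant_zero] using hmgf 0 ξ t) isClosed_closure hcover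
    rw [EReal.le_neg]
    refine limsup_log_le (c := c) (Eventually.of_forall fun t => ?_)
    have hsub : {ω | X t ω ∈ G} ⊆ {ω | X t ω ∈ closure G} :=
      Set.preimage_mono subset_closure
    exact (measure_mono hsub).trans (hc t)
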